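/- Let $1\le m\le n-1$ be integers and let $\mu$ be a Radon measure on $\mathbb{R}^n$, i.e. a Borel regular outer measure that is finite on compact sets. Write $B(x,r)$ and $U(x,r)$ for the closed and the open Euclidean ball with center $x$ and radius $r$. A *bad cone* is a set $X=X(V,\alpha)=\{x\in\mathbb{R}^n:\operatorname{dist}(x,V)>\alpha\operatorname{dist}(x,V^\perp)\}$, where $V$ is an $m$-dimensional linear subspace of $\mathbb{R}^n$ and $\alpha\in(0,\infty)$; put $X_x=x+X$. A *dyadic cube* is a set $Q=\prod_{i=1}^n\left[\frac{j_i}{2^k},\frac{j_i+1}{2^k}\right)$ with $k,j_1,\dots,j_n\in\mathbb{Z}$; its side length is $\operatorname{side}Q=2^{-k}$ and its center is denoted $x_Q$. For a dyadic cube $Q$ and a bad cone $X=X(V,\alpha)$ let $$r_{Q,X}=81\sqrt n\,\max(\alpha,1/\alpha)\operatorname{side}Q,\qquad A_{Q,X}=\Big(\bigcup_{x\in Q}X_x\Big)\cap B(x_Q,r_{Q,X})\setminus U(x_Q,r_{Q,X}/3),$$ and let $\Delta^*_{Q,X}$ be the set of all dyadic cubes $R$ with $\operatorname{side}R=\operatorname{side}Q$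 and $R\cap A_{Q,X}\neq\emptyset$. Let $$\mathsf{Defect}(\mu,Q,X)=\sum_{R\in\Delta^*_{Q,X}}\frac{\mu(R)}{\mu(Q)}\ \text{ if }\mu(Q)>0,\qquad \mathsf{Defect}(\mu,Q,X)=0\ \text{ if }\mu(Q)=0,$$ and define the *conical Dini function* $G_{\mu,X}:\mathbb{R}^n\to[0,\infty]$ by $$G_{\mu,X}(x)=\sum_{Q\ni x,\ \operatorname{side}Q\le 1}\mathsf{Defect}(\mu,Q,X),$$ the sum being over all dyadic cubes $Q$ of side length at most $1$ that contain $x$. Finally let $$\underline{D}^m(\mu,x)=\liminf_{r\downarrow 0}\frac{\mu(B(x,r))}{r^m}\in[0,\infty].$$ Then: 1. At $\mu$-a.e. $x\in\mathbb{R}^n$ such that $G_{\mu,X}(x)<\infty$ for some bad cone $X$, we have $\underline{D}^m(\mu,x)>0$. 2. At $\mu$-a.e. $x\in\mathbb{R}^n$ such that $\underline{D}^m(\mu,x)=0$, we have $G_{\mu,X}(x)=\infty$ for every bad cone $X$. -/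

import Mathlib

open MeasureTheory Filter Topology
open scoped ENNReal

namespace ConicalDini

/-- A bad cone `X(V, α)` in `ℝⁿ`, given by its data: an `m`-dimensional linear subspace `V` and an
opening `α ∈ (0, ∞)`. -/
structure BadCone (n m : ℕ) where
  V : Submodule ℝ (EuclideanSpace ℝ (Fin n))
  finrank_V : Module.finrank ℝ V = m
  opening : ℝ
  opening_pos : 0 < opening

namespace BadCone

variable {n m : ℕ}

/-- The set `X = {x : dist (x, V) > α dist (x, Vᗮ)}`. -/
noncomputable def carrier (X : BadCone n m) : Set (EuclideanSpace ℝ (Fin n)) :=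
  {x | X.opening * Metric.infDist x (X.Vᗮ : Set (EuclideanSpace ℝ (Fin n))) <
    Metric.infDist x (X.V : Set (EuclideanSpace ℝ (Fin n)))}

/-- The translated cone `X_x = {x + y : y ∈ X}`. -/
noncomputable def translate (X : BadCone n m) (x : EuclideanSpace ℝ (Fin n)) :
    Set (EuclideanSpace ℝ (Fin n)) :=
  (fun y => x + y) '' X.carrier

end BadCone

/-- A (half-open) dyadic cube in `ℝⁿ`, given by its generation `k ∈ ℤ` and its position
`j ∈ ℤⁿ`. For `n ≥ 1`, distinct data give distinct sets. -/
@[ext]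
structure DyadicCube (n : ℕ) where
  gen : ℤ
  pos : Fin n → ℤ

namespace DyadicCube

variable {n : ℕ}

/-- The side length `2⁻ᵏ`. -/
noncomputable def side (Q : DyadicCube n) : ℝ := (2 : ℝ) ^ (-Q.gen)

/-- The set `∏ᵢ [jᵢ / 2ᵏ, (jᵢ + 1) / 2ᵏ)`. -/
noncomputable def carrier (Q : DyadicCube n) : Set (EuclideanSpace ℝ (Fin n)) :=
  {x | ∀ i, x i ∈ Set.Ico ((Q.pos i : ℝ) / (2 : ℝ) ^ Q.gen)
    (((Q.pos i : ℝ) + 1) / (2 : ℝ) ^ Q.gen)}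

/-- The geometric center `x_Q`. -/
noncomputable def center (Q : DyadicCube n) : EuclideanSpace ℝ (Fin n) :=
  WithLp.toLp 2 fun i => ((Q.pos i : ℝ) + 1 / 2) / (2 : ℝ) ^ Q.gen

end DyadicCube

variable {n m : ℕ}

/-- The radius `r_{Q,X} = 81 √n max (α, 1/α) side Q`. -/
noncomputable def radius (Q : DyadicCube n) (X : BadCone n m) : ℝ :=
  81 * Real.sqrt n * max X.opening (1 / X.opening) * Q.side

/-- The conical annulus `A_{Q,X} = X_Q ∩ B(x_Q, r_{Q,X}) \ U(x_Q, r_{Q,X}/3)`, where `X_Q` is the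
union of the translates `X_x` over `x ∈ Q`, `B` is a closed and `U` an open ball. -/
noncomputable def conicalAnnulus (Q : DyadicCube n) (X : BadCone n m) :
    Set (EuclideanSpace ℝ (Fin n)) :=
  ((⋃ x ∈ Q.carrier, X.translate x) ∩ Metric.closedBall Q.center (radius Q X)) \
    Metric.ball Q.center (radius Q X / 3)

/-- The discretized conical annulus `Δ*_{Q,X}`: the dyadic cubes of the same side length as `Q`
which meet `A_{Q,X}`. -/
def discreteAnnulus (Q : DyadicCube n) (X : BadCone n m) : Set (DyadicCube n) :=
  {R | R.side = Q.side ∧ (R.carrier ∩ conicalAnnulus Q X).Nonempty}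

open Classical in
/-- The conical defect `∑_{R ∈ Δ*_{Q,X}} μ(R) / μ(Q)`, set to be `0` if `μ(Q) = 0`. -/
noncomputable def defect (μ : Measure (EuclideanSpace ℝ (Fin n))) (Q : DyadicCube n)
    (X : BadCone n m) : ℝ≥0∞ :=
  if μ Q.carrier = 0 then 0
  else ∑' R : discreteAnnulus Q X, μ (R : DyadicCube n).carrier / μ Q.carrier

/-- The conical Dini function `G_{μ,X}(x)`, the sum of the conical defects of all dyadic cubes of
side length at most `1` that contain `x`. -/
noncomputable def conicalDini (μ : Measure (EuclideanSpace ℝ (Fin n))) (X : BadCone n m)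
    (x : EuclideanSpace ℝ (Fin n)) : ℝ≥0∞ :=
  ∑' Q : {Q : DyadicCube n // Q.side ≤ 1}, Q.1.carrier.indicator (fun _ => defect μ Q.1 X) x

/-- The lower `m`-density `liminf_{r ↓ 0} μ(B(x,r)) / r^m`, with closed balls. -/
noncomputable def lowerDensity (m : ℕ) (μ : Measure (EuclideanSpace ℝ (Fin n)))
    (x : EuclideanSpace ℝ (Fin n)) : ℝ≥0∞ :=
  liminf (fun r : ℝ => μ (Metric.closedBall x r) / ENNReal.ofReal (r ^ m)) (𝓝[>] (0 : ℝ))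

end ConicalDini

/-! If the Dini function is bounded on a set `E` of finite measure, integrating it over `E` bounds
the sum of `μ R` over all `R ∈ Δ Q`, with `Q` running through the cubes at least half filled by `E`.
By Borel–Cantelli almost every point lies in only finitely many such `R`, and by dyadic density all
small cubes around almost every point of `E` are half filled. So these points split into countably
many pieces where no two nearby points differ by a cone vector: Lipschitz graphs over an
`m`-dimensional space (`exists_cover_familyDini_lt_top`). Projecting `μ` from a graph and
differentiating Lebesgue measure against the image gives positive lower density
(`ae_lowerDensity_pos`). A countable dense set of linear maps handles all cones at once. -/

namespace ConicalDini

/-! ### Geometry of dyadic cubes -/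

namespace DyadicCube

variable {n : ℕ}

instance : Countable (DyadicCube n) :=
  Function.Injective.countable (f := fun Q : DyadicCube n => (Q.gen, Q.pos)) fun Q R h => by
    simp only [Prod.mk.injEq] at h
    exact DyadicCube.ext h.1 h.2

lemma side_pos (Q : DyadicCube n) : 0 < Q.side := by
  unfold side; positivity

lemma side_eq_iff {Q R : DyadicCube n} : R.side = Q.side ↔ R.gen = Q.gen := by
  unfold side
  rw [zpow_right_inj₀ (by norm_num) (by norm_num), neg_inj]

lemma side_le_one_iff {Q : DyadicCube n} : Q.side ≤ 1 ↔ 0 ≤ Q.gen := by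
  unfold side
  rw [zpow_le_one_iff_right₀ (by norm_num)]
  omega

lemma measurableSet_carrier (Q : DyadicCube n) : MeasurableSet Q.carrier := by
  have : Q.carrier = ⋂ i, (fun x : EuclideanSpace ℝ (Fin n) => x i) ⁻¹'
      Set.Ico ((Q.pos i : ℝ) / (2 : ℝ) ^ Q.gen) (((Q.pos i : ℝ) + 1) / (2 : ℝ) ^ Q.gen) := by
    ext x; simp [carrier]
  rw [this]
  refine MeasurableSet.iInter fun i => measurableSet_Ico.preimage ?_
  exact (by fun_prop : Continuous fun x : EuclideanSpace ℝ (Fin n) => x i).measurable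

lemma mem_carrier_iff {Q : DyadicCube n} {x : EuclideanSpace ℝ (Fin n)} :
    x ∈ Q.carrier ↔ ∀ i, (Q.pos i : ℝ) ≤ x i * 2 ^ Q.gen ∧ x i * 2 ^ Q.gen < Q.pos i + 1 := by
  have h : (0 : ℝ) < 2 ^ Q.gen := by positivity
  simp only [carrier, Set.mem_ofPred_eq, Set.mem_Ico, div_le_iff₀ h, lt_div_iff₀ h]

lemma exists_mem (k : ℤ) (x : EuclideanSpace ℝ (Fin n)) :
    ∃ Q : DyadicCube n, Q.gen = k ∧ x ∈ Q.carrier :=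
  ⟨⟨k, fun i => ⌊x i * 2 ^ k⌋⟩, rfl, mem_carrier_iff.2 fun _ =>
    ⟨Int.floor_le _, Int.lt_floor_add_one _⟩⟩

lemma eq_of_mem {Q R : DyadicCube n} (h : Q.gen = R.gen) {x : EuclideanSpace ℝ (Fin n)}
    (hQ : x ∈ Q.carrier) (hR : x ∈ R.carrier) : Q = R := by
  refine DyadicCube.ext h (funext fun i => ?_)
  have h1 := mem_carrier_iff.1 hQ i
  have h2 := mem_carrier_iff.1 hR i
  rw [h] at h1
  have e1 : (Q.pos i : ℝ) < R.pos i + 1 := h1.1.trans_lt h2.2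
  have e2 : (R.pos i : ℝ) < Q.pos i + 1 := h2.1.trans_lt h1.2
  norm_cast at e1 e2
  omega

lemma carrier_subset {Q R : DyadicCube n} (h : R.gen ≤ Q.gen) {z : EuclideanSpace ℝ (Fin n)}
    (hQ : z ∈ Q.carrier) (hR : z ∈ R.carrier) : Q.carrier ⊆ R.carrier := by
  intro x hx
  obtain ⟨d, hd⟩ := Int.eq_ofNat_of_zero_le (sub_nonneg.2 h)
  have hpow : (2 : ℝ) ^ Q.gen = 2 ^ R.gen * 2 ^ d := by
    rw [← zpow_natCast, ← zpow_add₀ (by norm_num), ← hd]; congr 1; omega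
  have hp : (0 : ℝ) < 2 ^ d := by positivity
  rw [mem_carrier_iff] at hQ hR hx ⊢
  intro i
  obtain ⟨a1, a2⟩ := hQ i
  obtain ⟨b1, b2⟩ := hR i
  obtain ⟨c1, c2⟩ := hx i
  rw [hpow, ← mul_assoc] at a1 a2 c1 c2
  have e1 : (R.pos i : ℝ) * 2 ^ d < Q.pos i + 1 :=
    (mul_le_mul_of_nonneg_right b1 hp.le).trans_lt a2
  have e2 : (Q.pos i : ℝ) < (R.pos i + 1) * 2 ^ d :=
    a1.trans_lt (mul_lt_mul_of_pos_right b2 hp)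
  -- All quantities are integers, so `A < B + 1` improves to `A ≤ B`.
  have f1 : (R.pos i : ℝ) * 2 ^ d ≤ Q.pos i := by
    norm_cast at e1 ⊢; omega
  have f2 : (Q.pos i : ℝ) + 1 ≤ (R.pos i + 1) * 2 ^ d := by
    norm_cast at e2 ⊢
  exact ⟨le_of_mul_le_mul_right (f1.trans c1) hp, lt_of_mul_lt_mul_right (c2.trans_le f2) hp.le⟩

lemma dist_le {Q : DyadicCube n} {x y : EuclideanSpace ℝ (Fin n)} (hx : x ∈ Q.carrier)
    (hy : y ∈ Q.carrier) : dist x y ≤ √n * Q.side := by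
  rw [EuclideanSpace.dist_eq]
  have hs := Q.side_pos
  have hle : ∀ i, dist (x i) (y i) ^ 2 ≤ Q.side ^ 2 := fun i => by
    have h1 := hx i
    have h2 := hy i
    have : Q.side = (((Q.pos i : ℝ) + 1) / (2 : ℝ) ^ Q.gen) - (Q.pos i : ℝ) / (2 : ℝ) ^ Q.gen := by
      rw [side, zpow_neg]; ring
    rw [Real.dist_eq, sq_abs]
    refine sq_le_sq' ?_ ?_ <;> linarith [h1.1, h1.2, h2.1, h2.2]
  calc √(∑ i, dist (x i) (y i) ^ 2) ≤ √(∑ _i : Fin n, Q.side ^ 2) :=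
        Real.sqrt_le_sqrt (Finset.sum_le_sum fun i _ => hle i)
    _ = √n * Q.side := by
        rw [Finset.sum_const, Finset.card_univ, Fintype.card_fin, nsmul_eq_mul,
          Real.sqrt_mul (by positivity), Real.sqrt_sq hs.le]

lemma center_mem (Q : DyadicCube n) : Q.center ∈ Q.carrier := by
  intro i
  have h : (0 : ℝ) < 2 ^ Q.gen := by positivity
  simp only [center]
  constructor
  · gcongr; linarith
  · gcongr; norm_num

lemma measure_carrier_lt_top (μ : Measure (EuclideanSpace ℝ (Fin n)))
    [IsFiniteMeasureOnCompacts μ] (Q : DyadicCube n) : μ Q.carrier < ⊤ :=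
  (measure_mono fun _ hx => Metric.mem_closedBall.2 (dist_le hx Q.center_mem)).trans_lt
    (isCompact_closedBall Q.center (√n * Q.side)).measure_lt_top

end DyadicCube

variable {n m : ℕ}

/-! ### Dyadic density -/

/-- A dyadic density theorem. -/
lemma ae_eventually_measure_le (μ : Measure (EuclideanSpace ℝ (Fin n)))
    [IsFiniteMeasureOnCompacts μ] (E : Set (EuclideanSpace ℝ (Fin n))) (hE : μ E ≠ ⊤) :
    ∀ᵐ x ∂μ, x ∈ E → ∃ k : ℕ, ∀ Q : DyadicCube n, (k : ℤ) ≤ Q.gen → x ∈ Q.carrier →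
      μ Q.carrier ≤ 2 * μ (Q.carrier ∩ E) := by
  set B := {x | x ∈ E ∧ ∀ k : ℕ, ∃ Q : DyadicCube n, (k : ℤ) ≤ Q.gen ∧ x ∈ Q.carrier ∧
      2 * μ (Q.carrier ∩ E) < μ Q.carrier} with hB
  have hBE : B ⊆ E := fun x hx => hx.1
  have hBtop : μ B ≠ ⊤ := ((measure_mono hBE).trans_lt hE.lt_top).ne
  suffices h : μ B = 0 by
    filter_upwards [measure_eq_zero_iff_ae_notMem.1 h] with x hx hxE
    by_contra! hcon
    exact hx ⟨hxE, hcon⟩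
  have key : ∀ U, B ⊆ U → IsOpen U → 2 * μ B ≤ μ U := by
    intro U hBU hU
    set F := {Q : DyadicCube n | 0 ≤ Q.gen ∧ 2 * μ (Q.carrier ∩ E) < μ Q.carrier ∧
      Q.carrier ⊆ U}
    -- The maximal cubes of `F`; they exist because generations in `F` are bounded below by `0`.
    set M := {Q : DyadicCube n | Q ∈ F ∧ ∀ R ∈ F, (Q.carrier ∩ R.carrier).Nonempty →
      Q.gen ≤ R.gen}
    have hMdisj : M.PairwiseDisjoint DyadicCube.carrier := by
      intro Q hQ R hR hne
      by_contra hd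
      obtain ⟨x, hx⟩ := Set.not_disjoint_iff_nonempty_inter.1 hd
      exact hne (DyadicCube.eq_of_mem
        (le_antisymm (hQ.2 R hR.1 ⟨x, hx⟩) (hR.2 Q hQ.1 ⟨x, hx.symm⟩)) hx.1 hx.2)
    have hcover : B ⊆ ⋃ Q ∈ M, Q.carrier ∩ E := by
      intro x hx
      have hex : ∃ k : ℕ, ∃ Q ∈ F, Q.gen = k ∧ x ∈ Q.carrier := by
        obtain ⟨ε, hε, hball⟩ := Metric.isOpen_iff.1 hU x (hBU hx)
        obtain ⟨k, hk⟩ : ∃ k : ℕ, √n * (1 / 2 : ℝ) ^ k < ε := by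
          have : Tendsto (fun k : ℕ => √n * (1 / 2 : ℝ) ^ k) atTop (𝓝 (√n * 0)) :=
            (tendsto_pow_atTop_nhds_zero_of_lt_one (by norm_num) (by norm_num)).const_mul _
          rw [mul_zero] at this
          exact (this.eventually (gt_mem_nhds hε)).exists
        obtain ⟨Q, hkQ, hxQ, hQ⟩ := hx.2 k
        have hs : Q.side ≤ (1 / 2 : ℝ) ^ k := by
          rw [DyadicCube.side, one_div, inv_pow, ← zpow_natCast, ← zpow_neg]
          exact zpow_le_zpow_right₀ (by norm_num) (by omega)
        refine ⟨Q.gen.toNat, Q, ⟨by omega, hQ, fun y hy => hball ?_⟩, by omega, hxQ⟩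
        refine (DyadicCube.dist_le hy hxQ).trans_lt (lt_of_le_of_lt ?_ hk)
        gcongr
      classical
      obtain ⟨Q, hQF, hQk, hxQ⟩ := Nat.find_spec hex
      refine Set.mem_iUnion₂.2 ⟨Q, ⟨hQF, fun R hR ⟨z, hz⟩ => ?_⟩, hxQ, hx.1⟩
      by_contra! hlt
      have hxR := DyadicCube.carrier_subset hlt.le hz.1 hz.2 hxQ
      have := Nat.find_min' hex (m := R.gen.toNat) ⟨R, hR, by have := hR.1; omega, hxR⟩
      have := hR.1
      omega
    calc 2 * μ B ≤ 2 * ∑' Q : M, μ (Q.1.carrier ∩ E) := by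
          gcongr
          exact (measure_mono hcover).trans (measure_biUnion_le μ M.to_countable _)
      _ = ∑' Q : M, 2 * μ (Q.1.carrier ∩ E) := ENNReal.tsum_mul_left.symm
      _ ≤ ∑' Q : M, μ Q.1.carrier := ENNReal.tsum_le_tsum fun Q => Q.2.1.2.1.le
      _ = μ (⋃ Q ∈ M, Q.carrier) := (measure_biUnion M.to_countable hMdisj
          fun Q _ => Q.measurableSet_carrier).symm
      _ ≤ μ U := measure_mono (Set.iUnion₂_subset fun Q hQ => hQ.1.2.2)
  -- Outer regularity lets `U` shrink to `B`.
  have h2 : 2 * μ B ≤ μ B := by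
    refine ENNReal.le_of_forall_pos_le_add fun ε hε _ => ?_
    obtain ⟨U, hBU, hU, hlt⟩ := B.exists_isOpen_lt_add hBtop (ENNReal.coe_pos.2 hε).ne'
    exact (key U hBU hU).trans hlt.le
  rw [two_mul] at h2
  by_contra h0
  exact (ENNReal.lt_add_right hBtop h0).not_ge h2

/-! ### Dini functions of cube families and Borel–Cantelli -/

/-- The sum `∑_{R ∈ Δ} μ(R) / μ(Q)`, set to be `0` if `μ(Q) = 0`. -/
noncomputable def familyDefect (μ : Measure (EuclideanSpace ℝ (Fin n))) (Q : DyadicCube n)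
    (Δ : Set (DyadicCube n)) : ℝ≥0∞ :=
  open Classical in
  if μ Q.carrier = 0 then 0 else ∑' R : Δ, μ (R : DyadicCube n).carrier / μ Q.carrier

/-- The Dini function attached to a family `Δ` of sets of cubes. -/
noncomputable def familyDini (μ : Measure (EuclideanSpace ℝ (Fin n)))
    (Δ : DyadicCube n → Set (DyadicCube n)) (x : EuclideanSpace ℝ (Fin n)) : ℝ≥0∞ :=
  ∑' Q : {Q : DyadicCube n // Q.side ≤ 1},
    Q.1.carrier.indicator (fun _ => familyDefect μ Q.1 (Δ Q.1)) x

lemma familyDini_le_conicalDini (μ : Measure (EuclideanSpace ℝ (Fin n)))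
    {Δ : DyadicCube n → Set (DyadicCube n)} {X : BadCone n m}
    (h : ∀ Q, Δ Q ⊆ discreteAnnulus Q X) (x : EuclideanSpace ℝ (Fin n)) :
    familyDini μ Δ x ≤ conicalDini μ X x := by
  refine ENNReal.tsum_le_tsum fun Q => Set.indicator_le_indicator ?_
  unfold familyDefect defect
  split_ifs
  · exact le_rfl
  · exact ENNReal.tsum_mono_subtype (fun R : DyadicCube n => μ R.carrier / μ Q.1.carrier) (h Q.1)

lemma measurable_familyDini (μ : Measure (EuclideanSpace ℝ (Fin n)))
    (Δ : DyadicCube n → Set (DyadicCube n)) : Measurable (familyDini μ Δ) :=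
  Measurable.tsum fun Q => measurable_const.indicator Q.1.measurableSet_carrier

lemma lintegral_familyDini (μ : Measure (EuclideanSpace ℝ (Fin n)))
    (Δ : DyadicCube n → Set (DyadicCube n)) (E : Set (EuclideanSpace ℝ (Fin n))) :
    ∫⁻ x in E, familyDini μ Δ x ∂μ =
      ∑' Q : {Q : DyadicCube n // Q.side ≤ 1},
        familyDefect μ Q.1 (Δ Q.1) * μ (Q.1.carrier ∩ E) := by
  unfold familyDini
  rw [lintegral_tsum fun Q =>
    (measurable_const.indicator Q.1.measurableSet_carrier).aemeasurable]
  congr 1 with Q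
  rw [lintegral_indicator_const Q.1.measurableSet_carrier,
    Measure.restrict_apply Q.1.measurableSet_carrier]

/-- `Q` is a cube of side at most one, charged by `μ`, at least half of which lies in `E`. -/
def IsDense (μ : Measure (EuclideanSpace ℝ (Fin n))) (E : Set (EuclideanSpace ℝ (Fin n)))
    (Q : DyadicCube n) : Prop :=
  0 ≤ Q.gen ∧ μ Q.carrier ≠ 0 ∧ μ Q.carrier ≤ 2 * μ (Q.carrier ∩ E)

lemma ae_eventually_isDense (μ : Measure (EuclideanSpace ℝ (Fin n)))
    [IsFiniteMeasureOnCompacts μ] (E : Set (EuclideanSpace ℝ (Fin n))) (hE : μ E ≠ ⊤) :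
    ∀ᵐ x ∂μ, x ∈ E → ∃ k : ℕ, ∀ Q : DyadicCube n, (k : ℤ) ≤ Q.gen → x ∈ Q.carrier →
      IsDense μ E Q := by
  have hnull : ∀ᵐ x ∂μ, ∀ Q : DyadicCube n, x ∈ Q.carrier → μ Q.carrier ≠ 0 := by
    refine ae_all_iff.2 fun Q => ?_
    by_cases h : μ Q.carrier = 0
    · filter_upwards [measure_eq_zero_iff_ae_notMem.1 h] with x hx hxQ using absurd hxQ hx
    · exact Eventually.of_forall fun _ _ => h
  filter_upwards [ae_eventually_measure_le μ E hE, hnull] with x hx hx0 hxE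
  obtain ⟨k, hk⟩ := hx hxE
  exact ⟨k, fun Q hQ hxQ => ⟨by omega, hx0 Q hxQ, hk Q hQ hxQ⟩⟩

/-- Input for Borel–Cantelli: for dense `Q` the inner sum is the defect times `μ Q`, at most twice
the contribution of `Q` to the integral over `E`. -/
lemma tsum_isDense_ne_top (μ : Measure (EuclideanSpace ℝ (Fin n)))
    [IsFiniteMeasureOnCompacts μ] (Δ : DyadicCube n → Set (DyadicCube n))
    {E : Set (EuclideanSpace ℝ (Fin n))} (hint : ∫⁻ x in E, familyDini μ Δ x ∂μ ≠ ⊤) :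
    ∑' P : (Σ Q : {Q : DyadicCube n // IsDense μ E Q}, Δ Q.1), μ P.2.1.carrier ≠ ⊤ := by
  rw [ENNReal.tsum_sigma']
  refine ((?_ : _ ≤ 2 * ∫⁻ x in E, familyDini μ Δ x ∂μ).trans_lt
    (ENNReal.mul_lt_top (by simp) hint.lt_top)).ne
  have h1 : ∀ Q : {Q : DyadicCube n // IsDense μ E Q}, ∑' R : Δ Q.1, μ R.1.carrier ≤
      2 * (familyDefect μ Q.1 (Δ Q.1) * μ (Q.1.carrier ∩ E)) := by
    rintro ⟨Q, -, h0, hQ⟩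
    calc ∑' R : Δ Q, μ R.1.carrier = familyDefect μ Q (Δ Q) * μ Q.carrier := by
          rw [familyDefect, if_neg h0, ← ENNReal.tsum_mul_right]
          congr 1 with R
          rw [ENNReal.div_mul_cancel h0 (Q.measure_carrier_lt_top μ).ne]
      _ ≤ familyDefect μ Q (Δ Q) * (2 * μ (Q.carrier ∩ E)) := by gcongr
      _ = _ := by ring
  refine (ENNReal.tsum_le_tsum h1).trans ?_
  rw [ENNReal.tsum_mul_left, lintegral_familyDini]
  gcongr
  exact ENNReal.tsum_mono_subtype
    (fun Q : DyadicCube n => familyDefect μ Q (Δ Q) * μ (Q.carrier ∩ E))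
    (s := {Q | IsDense μ E Q}) (t := {Q | Q.side ≤ 1})
    fun Q hQ => DyadicCube.side_le_one_iff.2 hQ.1

/-- Up to a null set, the points where the Dini function is finite lie in countably many sets, each
of which avoids, at all small scales, the cubes of `Δ Q` for all cubes `Q` which meet it. -/
lemma exists_cover_familyDini_lt_top (μ : Measure (EuclideanSpace ℝ (Fin n)))
    [IsFiniteMeasureOnCompacts μ] (Δ : DyadicCube n → Set (DyadicCube n)) :
    ∃ S : ℕ → ℕ → Set (EuclideanSpace ℝ (Fin n)),
      (∀ᵐ x ∂μ, familyDini μ Δ x < ⊤ → ∃ N k, x ∈ S N k) ∧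
      ∀ N (k : ℕ), ∀ x ∈ S N k, ∀ y ∈ S N k, ∀ Q R : DyadicCube n, (k : ℤ) ≤ Q.gen →
        x ∈ Q.carrier → y ∈ R.carrier → R ∉ Δ Q := by
  set E : ℕ → Set (EuclideanSpace ℝ (Fin n)) := fun N =>
    {x | familyDini μ Δ x ≤ N} ∩ Metric.closedBall 0 N with hEdef
  have hEm : ∀ N, MeasurableSet (E N) := fun N =>
    (measurableSet_le (measurable_familyDini μ Δ) measurable_const).inter
      Metric.isClosed_closedBall.measurableSet
  have hE : ∀ N, μ (E N) ≠ ⊤ := fun N =>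
    ((measure_mono Set.inter_subset_right).trans_lt
      (isCompact_closedBall _ _).measure_lt_top).ne
  have hint : ∀ N, ∫⁻ x in E N, familyDini μ Δ x ∂μ ≠ ⊤ := fun N => by
    refine ((setLIntegral_mono measurable_const fun x hx => hx.1).trans_lt ?_).ne
    rw [setLIntegral_const]
    exact ENNReal.mul_lt_top (by simp) (hE N).lt_top
  refine ⟨fun N k => {x | (∀ Q : DyadicCube n, (k : ℤ) ≤ Q.gen → x ∈ Q.carrier →
    IsDense μ (E N) Q) ∧ ∀ Q : DyadicCube n, (k : ℤ) ≤ Q.gen → IsDense μ (E N) Q →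
      ∀ R ∈ Δ Q, x ∉ R.carrier}, ?_, ?_⟩
  · have hdense := ae_all_iff.2 fun N => ae_eventually_isDense μ (E N) (hE N)
    have hbc := ae_all_iff.2 fun N =>
      ae_finite_setOfPred_mem (tsum_isDense_ne_top μ Δ (hint N))
    filter_upwards [hdense, hbc] with x hx1 hx2 hfin
    obtain ⟨N, hN⟩ : ∃ N, x ∈ E N := by
      obtain ⟨N₁, h₁⟩ := ENNReal.exists_nat_gt hfin.ne
      obtain ⟨N₂, h₂⟩ := exists_nat_ge ‖x‖
      refine ⟨max N₁ N₂, h₁.le.trans (by exact_mod_cast le_max_left _ _), ?_⟩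
      rw [mem_closedBall_zero_iff]
      exact h₂.trans (by exact_mod_cast le_max_right _ _)
    obtain ⟨k₁, hk₁⟩ := hx1 N hN
    obtain ⟨K, hK⟩ := ((hx2 N).image fun P => P.1.1.gen).bddAbove
    -- Start beyond the density threshold and past the last of the finitely many generations where
    -- `x` is hit.
    refine ⟨N, max k₁ (K + 1).toNat, fun Q hQ => hk₁ Q (by omega), fun Q hQ hd R hR hxR => ?_⟩
    have := hK ⟨⟨⟨Q, hd⟩, ⟨R, hR⟩⟩, hxR, rfl⟩
    dsimp only at this
    omega
  · intro N k x hx y hy Q R hk hxQ hyR hR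
    exact hy.2 Q hk (hx.1 Q hk hxQ) R hR hyR

/-! ### Lower density on Lipschitz graphs -/

/-- The lower density is positive almost everywhere on a set that a linear map to an
`m`-dimensional space embeds with Lipschitz inverse. -/
lemma ae_lowerDensity_pos (μ : Measure (EuclideanSpace ℝ (Fin n)))
    (T : EuclideanSpace ℝ (Fin n) →L[ℝ] EuclideanSpace ℝ (Fin m)) {β : ℝ} (hβ : 0 < β)
    {S : Set (EuclideanSpace ℝ (Fin n))} (hS : μ S ≠ ⊤)
    (hT : ∀ x ∈ S, ∀ y ∈ S, ‖x - y‖ ≤ β * ‖T (x - y)‖) :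
    ∀ᵐ x ∂μ, x ∈ S → 0 < lowerDensity m μ x := by
  have : IsFiniteMeasure (μ.restrict S) := isFiniteMeasure_restrict.2 hS
  have hTm : Measurable T := T.continuous.measurable
  set ν := (μ.restrict S).map T with hν
  have hball : ∀ x ∈ S, ∀ r, ν (Metric.closedBall (T x) r) ≤ μ (Metric.closedBall x (β * r)) := by
    intro x hx r
    rw [hν, Measure.map_apply hTm Metric.isClosed_closedBall.measurableSet,
      Measure.restrict_apply (hTm Metric.isClosed_closedBall.measurableSet)]
    refine measure_mono fun y hy => ?_
    have h1 : dist (T y) (T x) ≤ r := hy.1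
    rw [dist_eq_norm, ← map_sub] at h1
    rw [Metric.mem_closedBall, dist_eq_norm]
    exact (hT y hy.2 x hx).trans (by gcongr)
  -- The derivative of `volume` against `ν`, not the reverse, is finite `ν`-a.e.; this bounds `ν`
  -- below on small balls.
  have hae := ae_of_ae_map hTm.aemeasurable
    ((Besicovitch.ae_tendsto_rnDeriv (volume : Measure (EuclideanSpace ℝ (Fin m))) ν).and
      (Measure.rnDeriv_lt_top volume ν))
  filter_upwards [ae_imp_of_ae_restrict hae] with x hx hxS
  obtain ⟨hlim, hfin⟩ := hx hxS
  obtain ⟨K, hK1, hK2⟩ := ENNReal.lt_iff_exists_nnreal_btwn.1 hfin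
  set ω := (volume : Measure (EuclideanSpace ℝ (Fin m))) (Metric.closedBall 0 1) with hω
  have hω0 : ω ≠ 0 := (Metric.measure_closedBall_pos _ _ one_pos).ne'
  have hωtop : ω ≠ ⊤ := (isCompact_closedBall _ _).measure_lt_top.ne
  have hK0 : (K : ℝ≥0∞) ≠ 0 := (bot_lt_of_lt hK1).ne'
  set c : ℝ≥0∞ := ENNReal.ofReal ((1 / β) ^ m) * ω / K with hc
  have hc0 : 0 < c := ENNReal.div_pos
    (mul_ne_zero (ENNReal.ofReal_pos.2 (by positivity)).ne' hω0) ENNReal.coe_ne_top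
  have hscale : Tendsto (fun r : ℝ => r / β) (𝓝[>] 0) (𝓝[>] 0) := by
    refine tendsto_nhdsWithin_iff.2 ⟨?_, ?_⟩
    · have : Tendsto (fun r : ℝ => r / β) (𝓝 0) (𝓝 (0 / β)) := tendsto_id.div_const β
      rw [zero_div] at this
      exact this.mono_left nhdsWithin_le_nhds
    · filter_upwards [self_mem_nhdsWithin] with r hr using div_pos hr hβ
  refine hc0.trans_le (le_liminf_of_le (by isBoundedDefault) ?_)
  filter_upwards [hscale.eventually (hlim.eventually (gt_mem_nhds hK1)), self_mem_nhdsWithin]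
    with r hr hr0
  have hr0 : 0 < r := hr0
  have hνb := hball x hxS (r / β)
  rw [mul_div_cancel₀ _ hβ.ne'] at hνb
  have hνtop : ν (Metric.closedBall (T x) (r / β)) ≠ ⊤ := measure_ne_top _ _
  have h1 : volume (Metric.closedBall (T x) (r / β)) ≤ K * μ (Metric.closedBall x r) := by
    refine le_trans ?_ (mul_le_mul_right hνb K)
    by_cases h0 : ν (Metric.closedBall (T x) (r / β)) = 0
    -- Here the quotient would be `⊤`, as balls have positive volume.
    · rw [h0, ENNReal.div_zero] at hr
      · exact absurd hr not_top_lt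
      · exact (Metric.measure_closedBall_pos _ _ (div_pos hr0 hβ)).ne'
    · exact (ENNReal.div_le_iff h0 hνtop).1 hr.le
  rw [Measure.addHaar_closedBall' _ _ (div_pos hr0 hβ).le, finrank_euclideanSpace_fin,
    div_eq_mul_one_div, mul_pow, ENNReal.ofReal_mul (by positivity), ← hω] at h1
  rw [ENNReal.le_div_iff_mul_le (.inl (ENNReal.ofReal_pos.2 (by positivity)).ne')
    (.inl ENNReal.ofReal_ne_top), hc, ← ENNReal.mul_div_right_comm]
  refine ENNReal.div_le_of_le_mul ?_
  calc _ = ENNReal.ofReal (r ^ m) * ENNReal.ofReal ((1 / β) ^ m) * ω := by ring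
    _ ≤ _ := h1.trans_eq (mul_comm _ _)

/-! ### Cones defined by linear maps -/

/-- The cubes of the size of `Q` that contain a point of `Q + {z : β ‖T z‖ < ‖z‖}` whose distance to
the center of `Q` lies between `a side Q` and `b side Q`. -/
def linearAnnulus (T : EuclideanSpace ℝ (Fin n) →L[ℝ] EuclideanSpace ℝ (Fin m)) (β a b : ℝ)
    (Q : DyadicCube n) : Set (DyadicCube n) :=
  {R | R.gen = Q.gen ∧ ∃ y ∈ R.carrier, ∃ x ∈ Q.carrier, β * ‖T (y - x)‖ < ‖y - x‖ ∧
    a * Q.side ≤ dist y Q.center ∧ dist y Q.center ≤ b * Q.side}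

lemma ae_lowerDensity_pos_of_familyDini (hn : 0 < n) (μ : Measure (EuclideanSpace ℝ (Fin n)))
    [IsFiniteMeasureOnCompacts μ] (T : EuclideanSpace ℝ (Fin n) →L[ℝ] EuclideanSpace ℝ (Fin m))
    {β a b : ℝ} (hβ : 0 < β) (ha : 0 ≤ a) (hab : 2 * a + 3 * √n ≤ b) :
    ∀ᵐ x ∂μ, familyDini μ (linearAnnulus T β a b) x < ⊤ → 0 < lowerDensity m μ x := by
  have hsn : 0 < √(n : ℝ) := Real.sqrt_pos.2 (by exact_mod_cast hn)
  obtain ⟨S, hcov, hS⟩ := exists_cover_familyDini_lt_top μ (linearAnnulus T β a b)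
  have hpiece : ∀ N k : ℕ, ∀ P : DyadicCube n, P.gen = k →
      ∀ x ∈ S N k ∩ P.carrier, ∀ y ∈ S N k ∩ P.carrier, ‖x - y‖ ≤ β * ‖T (x - y)‖ := by
    rintro N k P hP y ⟨hyS, hyP⟩ x ⟨hxS, hxP⟩
    by_contra! hlt
    have hpos : 0 < ‖y - x‖ := lt_of_le_of_lt (by positivity) hlt
    have hasn : 0 < a + √n := by positivity
    -- With side `s = 2 ^ j`, `(a + √n) s ≤ ‖y - x‖ < 2 (a + √n) s`. Replacing `x` by the center of
    -- its cube costs at most `√n s`, hence the bounds `a s` and `(2 a + 3 √n) s`.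
    obtain ⟨j, hj1, hj2⟩ := exists_mem_Ico_zpow (div_pos hpos hasn) one_lt_two
    rw [le_div_iff₀ hasn] at hj1
    rw [div_lt_iff₀ hasn, zpow_add₀ two_ne_zero, zpow_one] at hj2
    obtain ⟨Q, hQ, hxQ⟩ := DyadicCube.exists_mem (-j) x
    obtain ⟨R, hR, hyR⟩ := DyadicCube.exists_mem (-j) y
    have hside : Q.side = 2 ^ j := by rw [DyadicCube.side, hQ, neg_neg]
    have hj : (k : ℤ) ≤ -j := by
      have h1 : ‖y - x‖ ≤ √n * P.side := by
        rw [← dist_eq_norm]; exact DyadicCube.dist_le hyP hxP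
      have h2 : (2 : ℝ) ^ j ≤ 2 ^ (-(k : ℤ)) := by
        rw [DyadicCube.side, hP] at h1
        have h3 : (2 : ℝ) ^ j * √n ≤ 2 ^ (-(k : ℤ)) * √n := by
          nlinarith [mul_nonneg ha (zpow_nonneg zero_le_two j : (0 : ℝ) ≤ 2 ^ j)]
        exact le_of_mul_le_mul_right h3 hsn
      have := (zpow_le_zpow_iff_right₀ (one_lt_two : (1 : ℝ) < 2)).1 h2
      omega
    have hc := DyadicCube.dist_le hxQ Q.center_mem
    have hs := Q.side_pos
    rw [← hside] at hj1 hj2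
    rw [← dist_eq_norm] at hj1 hj2
    refine hS N k x hxS y hyS Q R (hQ ▸ hj) hxQ hyR
      ⟨hR.trans hQ.symm, y, hyR, x, hxQ, hlt, ?_, ?_⟩
    · have := dist_triangle y Q.center x
      rw [dist_comm Q.center x] at this
      nlinarith
    · have := dist_triangle y x Q.center
      nlinarith
  have hall : ∀ᵐ x ∂μ, ∀ N k : ℕ, ∀ P : DyadicCube n, P.gen = k →
      x ∈ S N k ∩ P.carrier → 0 < lowerDensity m μ x := by
    simp only [ae_all_iff]
    intro N k P hP
    exact ae_lowerDensity_pos μ T hβ ((measure_mono Set.inter_subset_right).trans_lt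
      (P.measure_carrier_lt_top μ)).ne (hpiece N k P hP)
  filter_upwards [hcov, hall] with x hx hx' hfin
  obtain ⟨N, k, hxS⟩ := hx hfin
  obtain ⟨P, hP, hxP⟩ := DyadicCube.exists_mem (k : ℤ) x
  exact hx' N k P hP ⟨hxS, hxP⟩

/-! ### Reduction to countably many cones -/

namespace BadCone

/-- `T` is orthogonal projection onto `V` in coordinates. Off the cone `‖z‖ ≤ (1 + α) ‖T z‖`, and
perturbing `T` loses at most `‖z‖ / 2`, which doubles the constant. -/
lemma exists_linear_cone_subset (X : BadCone n m) :
    ∃ T : EuclideanSpace ℝ (Fin n) →L[ℝ] EuclideanSpace ℝ (Fin m), ∀ T',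
      ‖T' - T‖ ≤ 1 / (2 * (1 + X.opening)) → ∀ β, 2 * (1 + X.opening) ≤ β →
        ∀ z, β * ‖T' z‖ < ‖z‖ → z ∈ X.carrier := by
  have hα := X.opening_pos
  let e : X.V ≃ₗᵢ[ℝ] EuclideanSpace ℝ (Fin m) :=
    ((stdOrthonormalBasis ℝ X.V).reindex (finCongr X.finrank_V)).repr
  refine ⟨e.toContinuousLinearEquiv.toContinuousLinearMap ∘L X.V.orthogonalProjectionOnto,
    fun T' hT' β hβ z hz => ?_⟩
  by_contra hcon
  have h1 : Metric.infDist z X.V ≤ X.opening * Metric.infDist z X.Vᗮ := not_lt.1 hcon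
  have h2 : Metric.infDist z X.Vᗮ ≤ ‖X.V.starProjection z‖ := by
    have := Metric.infDist_le_dist_of_mem (x := z) (X.V.sub_starProjection_mem_orthogonal z)
    rwa [dist_eq_norm, sub_sub_cancel] at this
  have h3 : ‖z - X.V.starProjection z‖ = Metric.infDist z X.V := by
    rw [Submodule.starProjection_minimal, Metric.infDist_eq_iInf]
    simp only [dist_eq_norm]
    rfl
  have h4 : ‖z‖ ≤ ‖z - X.V.starProjection z‖ + ‖X.V.starProjection z‖ := by
    simpa using norm_add_le (z - X.V.starProjection z) (X.V.starProjection z)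
  set T := e.toContinuousLinearEquiv.toContinuousLinearMap ∘L X.V.orthogonalProjectionOnto
  have h5 : ‖T z‖ = ‖X.V.starProjection z‖ := by
    exact e.norm_map (X.V.orthogonalProjectionOnto z)
  have h6 : ‖T z‖ ≤ ‖T' z‖ + 1 / (2 * (1 + X.opening)) * ‖z‖ := by
    have h7 : ‖(T' - T) z‖ ≤ 1 / (2 * (1 + X.opening)) * ‖z‖ :=
      ((T' - T).le_opNorm z).trans (by gcongr)
    have h8 : ‖T z‖ ≤ ‖T' z‖ + ‖(T' - T) z‖ := by
      have := norm_sub_le (T' z) ((T' - T) z)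
      simpa using this
    linarith
  have h9 : ‖z‖ ≤ (1 + X.opening) * ‖T z‖ := by rw [h5]; nlinarith
  have h10 : (1 + X.opening) * (1 / (2 * (1 + X.opening)) * ‖z‖) = ‖z‖ / 2 := by field_simp
  have h11 : ‖z‖ ≤ 2 * (1 + X.opening) * ‖T' z‖ := by nlinarith
  nlinarith [norm_nonneg (T' z)]

end BadCone

lemma linearAnnulus_subset_discreteAnnulus {X : BadCone n m}
    {T : EuclideanSpace ℝ (Fin n) →L[ℝ] EuclideanSpace ℝ (Fin m)} {β a b : ℝ}
    (hX : ∀ z, β * ‖T z‖ < ‖z‖ → z ∈ X.carrier)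
    (ha : 81 * √n * max X.opening (1 / X.opening) / 3 ≤ a)
    (hb : b ≤ 81 * √n * max X.opening (1 / X.opening)) (Q : DyadicCube n) :
    linearAnnulus T β a b Q ⊆ discreteAnnulus Q X := by
  rintro R ⟨hR, y, hyR, x, hxQ, hlt, hya, hyb⟩
  have hs := Q.side_pos
  refine ⟨DyadicCube.side_eq_iff.2 hR, y, hyR, ⟨Set.mem_iUnion₂.2
    ⟨x, hxQ, y - x, hX _ hlt, add_sub_cancel x y⟩, ?_⟩, ?_⟩
  · rw [Metric.mem_closedBall, radius]
    exact hyb.trans (by gcongr)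
  · rw [Metric.mem_ball, not_lt, radius]
    refine le_trans ?_ hya
    rw [mul_div_right_comm]
    gcongr

lemma ae_lowerDensity_pos_of_conicalDini (hn : 0 < n) (μ : Measure (EuclideanSpace ℝ (Fin n)))
    [IsFiniteMeasureOnCompacts μ] :
    ∀ᵐ x ∂μ, ∀ X : BadCone n m, conicalDini μ X x < ⊤ → 0 < lowerDensity m μ x := by
  have hall : ∀ᵐ x ∂μ, ∀ i β a b : ℕ, 0 < β → 2 * (a : ℝ) + 3 * √n ≤ b →
      familyDini μ (linearAnnulus (TopologicalSpace.denseSeq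
        (EuclideanSpace ℝ (Fin n) →L[ℝ] EuclideanSpace ℝ (Fin m)) i) β a b) x < ⊤ →
      0 < lowerDensity m μ x := by
    simp only [ae_all_iff]
    intro i β a b hβ hab
    exact ae_lowerDensity_pos_of_familyDini hn μ _ (by exact_mod_cast hβ) (by positivity) hab
  filter_upwards [hall] with x hx X hfin
  have hα := X.opening_pos
  obtain ⟨T, hT⟩ := X.exists_linear_cone_subset
  obtain ⟨i, hi⟩ := (TopologicalSpace.denseRange_denseSeq
    (EuclideanSpace ℝ (Fin n) →L[ℝ] EuclideanSpace ℝ (Fin m))).exists_dist_lt T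
      (ε := 1 / (2 * (1 + X.opening))) (by positivity)
  rw [dist_comm, dist_eq_norm] at hi
  obtain ⟨β, hβ⟩ := exists_nat_ge (2 * (1 + X.opening))
  have hn1 : 1 ≤ √(n : ℝ) := Real.one_le_sqrt.2 (by exact_mod_cast hn)
  have hmax : 1 ≤ max X.opening (1 / X.opening) := by
    rcases le_total 1 X.opening with h | h
    · exact le_max_of_le_left h
    · exact le_max_of_le_right ((one_le_div hα).2 h)
  set c := 81 * √n * max X.opening (1 / X.opening) with hc
  have hcn : 81 * √n ≤ c := le_mul_of_one_le_right (by positivity) hmax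
  have hb0 : 0 ≤ c := by linarith
  have ha1 := Nat.ceil_lt_add_one (a := c / 3) (by positivity)
  have hb1 := Nat.lt_floor_add_one c
  -- Rounding the annulus inwards leaves room for `2 a + 3 √n ≤ b`, since `c ≥ 81 √n` and `√n ≥ 1`.
  refine hx i β ⌈c / 3⌉₊ ⌊c⌋₊ ?_ (by linarith)
    ((familyDini_le_conicalDini μ (linearAnnulus_subset_discreteAnnulus
      (hT _ hi.le β hβ) (Nat.le_ceil _) (Nat.floor_le hb0)) x).trans_lt hfin)
  have : (0 : ℝ) < β := by linarith
  exact_mod_cast this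

end ConicalDini

theorem corollary1p8 (n m : ℕ) (hm : 1 ≤ m) (hmn : m < n)
    (μ : MeasureTheory.Measure (EuclideanSpace ℝ (Fin n)))
    [MeasureTheory.IsFiniteMeasureOnCompacts μ] :
    (∀ᵐ x ∂μ, (∃ X : ConicalDini.BadCone n m, ConicalDini.conicalDini μ X x < ⊤) →
        0 < ConicalDini.lowerDensity m μ x) ∧
    (∀ᵐ x ∂μ, ConicalDini.lowerDensity m μ x = 0 →
        ∀ X : ConicalDini.BadCone n m, ConicalDini.conicalDini μ X x = ⊤) := by
  have h := ConicalDini.ae_lowerDensity_pos_of_conicalDini (m := m) (by omega : 0 < n) μ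
  refine ⟨?_, ?_⟩
  · filter_upwards [h] with x hx ⟨X, hX⟩ using hx X hX
  · filter_upwards [h] with x hx h0 X
    by_contra hX
    exact (hx X (lt_top_iff_ne_top.2 hX)).ne' h0
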